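/- Let $\psi_i(x)=r_ix+w_i$, $1\le i\le q$, with $0<r_i<1$ and $w_i\in\mathbb{R}^3$, and let $K\subset\mathbb{R}^3$ be the self-similar set without rotations that they generate, i.e. the unique nonempty compact set with $K=\bigcup_{i=1}^q\psi_i(K)$. For a two-dimensional linear subspace $V\subset\mathbb{R}^3$ let $\pi_V:\mathbb{R}^3\to V$ be the orthogonal projection, and let $B(0,R)$ denote the closed ball of radius $R$ centred at the origin. Then $K$ has the bi-Lipschitz property: for every two-dimensional subspace $V$ and every $\varepsilon>0$ there is a subset $K_{V,\varepsilon}\subset K$ such that $$\dim_{\mathrm H}K_{V,\varepsilon}\ \ge\ \dim_{\mathrm H}\pi_V(K)-\varepsilon$$ and the restriction $\pi_V|_{K_{V,\varepsilon}}$ is bi-Lipschitz. Moreover, $K_{V,\varepsilon}$ can be taken to be a self-similar set without rotations satisfying the very strong separation condition: whenever $R>0$ is such that $\psi_i(B(0,R))\subset B(0,R)$ for all $i$ (such $R$ always exists), $K_{V,\varepsilon}$ can be chosen as the attractor of finitely many maps $\varphi_j(x)=\rho_jx+v_j$, $0<\rho_j<1$, $v_j\in\mathbb{R}^3$, such that $\varphi_j(B(0,R))\subset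 B(0,R)$ for all $j$ and the balls $\varphi_j(B(0,R))$ are pairwise disjoint. -/

import Mathlib

open Set Metric
open scoped NNReal ENNReal

noncomputable section

/-- Euclidean three-space. -/
abbrev E3 : Type := EuclideanSpace ℝ (Fin 3)

/-- A finite family of contracting similitudes of `ℝ³` without rotations:
`ψ_i (x) = r_i x + w_i` with `0 < r_i < 1`. -/
structure HomothetyIFS (q : ℕ) where
  ratio : Fin q → ℝ
  shift : Fin q → E3
  ratio_pos : ∀ i, 0 < ratio i
  ratio_lt_one : ∀ i, ratio i < 1

namespace HomothetyIFS

variable {q : ℕ} (Ψ : HomothetyIFS q)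

/-- The `i`-th similitude of the family. -/
def map (i : Fin q) (x : E3) : E3 := Ψ.ratio i • x + Ψ.shift i

/-- `K` is the attractor of the family, i.e. the (unique) nonempty compact set with
`K = ⋃ i, ψ_i (K)`. -/
def IsAttractor (K : Set E3) : Prop :=
  K.Nonempty ∧ IsCompact K ∧ K = ⋃ i, Ψ.map i '' K

/-- Every similitude of the family maps the closed ball `B(0,R)` into itself. -/
def PreservesBall (R : ℝ) : Prop :=
  ∀ i, MapsTo (Ψ.map i) (closedBall 0 R) (closedBall 0 R)

/-- The very strong separation condition with respect to the reference ball `B(0,R)`: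
the similitudes map this closed ball into itself, and its images under the
similitudes (the balls of generation one) are pairwise disjoint. -/
def VerySeparated (R : ℝ) : Prop :=
  Ψ.PreservesBall R ∧
    Pairwise fun i j : Fin q =>
      Disjoint (Ψ.map i '' closedBall 0 R) (Ψ.map j '' closedBall 0 R)

/-- Every family admits a reference ball. -/
theorem exists_preservesBall : ∃ R : ℝ, 0 < R ∧ Ψ.PreservesBall R := by
  have h1 : ∀ i, 0 < 1 - Ψ.ratio i := fun i => sub_pos.2 (Ψ.ratio_lt_one i)
  have h0 : ∀ i ∈ Finset.univ, 0 ≤ ‖Ψ.shift i‖ / (1 - Ψ.ratio i) :=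
    fun i _ => div_nonneg (norm_nonneg _) (h1 i).le
  refine ⟨∑ i, ‖Ψ.shift i‖ / (1 - Ψ.ratio i) + 1,
    add_pos_of_nonneg_of_pos (Finset.sum_nonneg h0) one_pos, fun i x hx => ?_⟩
  have hi := Finset.single_le_sum h0 (Finset.mem_univ i)
  generalize ∑ i, ‖Ψ.shift i‖ / (1 - Ψ.ratio i) = S at hi hx ⊢
  rw [mem_closedBall_zero_iff] at hx ⊢
  rw [div_le_iff₀ (h1 i)] at hi
  calc ‖Ψ.ratio i • x + Ψ.shift i‖ ≤ ‖Ψ.ratio i • x‖ + ‖Ψ.shift i‖ := norm_add_le _ _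
    _ = Ψ.ratio i * ‖x‖ + ‖Ψ.shift i‖ := by
        rw [norm_smul, Real.norm_of_nonneg (Ψ.ratio_pos i).le]
    _ ≤ Ψ.ratio i * (S + 1) + S * (1 - Ψ.ratio i) := by
        have := mul_le_mul_of_nonneg_left hx (Ψ.ratio_pos i).le
        linarith
    _ ≤ S + 1 := by nlinarith [h1 i]

end HomothetyIFS

/-- The restriction of `f` to `s` is bi-Lipschitz. -/
def BiLipschitzOn {X Y : Type*} [PseudoEMetricSpace X] [PseudoEMetricSpace Y]
    (f : X → Y) (s : Set X) : Prop :=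
  (∃ C : ℝ≥0, LipschitzOnWith C f s) ∧ ∃ C : ℝ≥0, AntilipschitzWith C (s.domRestrict f)

/-- The bi-Lipschitz property: for every plane `V ∈ G(3,2)` and every `ε > 0` the set `B`
has a subset `A` with `dim_H A ≥ dim_H π_V(B) - ε` on which `π_V` is bi-Lipschitz. -/
def HasBiLipschitzProperty (B : Set E3) : Prop :=
  ∀ V : Submodule ℝ E3, Module.finrank ℝ V = 2 → ∀ ε : ℝ, 0 < ε →
    ∃ A : Set E3, A ⊆ B ∧
      dimH (V.orthogonalProjectionOnto '' B) ≤ dimH A + ENNReal.ofReal ε ∧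
      BiLipschitzOn V.orthogonalProjectionOnto A

end

/-! Let `d` lie strictly below the dimension of `π_V(K)`. At some small scale `η` the projection
contains an `η`-separated set of about `η⁻ᵈ` points (`exists_isSeparated_of_lt_dimH`). Above each
point choose a cylinder of `K` with ratio comparable to `η` (`IsAttractor.exists_piece`), so small
that the projected balls of the chosen cylinders stay disjoint. The chosen compositions form a new
family whose attractor `L` lies in `K` and whose ratios satisfy `∑ ρⱼᵈ ≥ 1`.

Disjointness then pays twice. Upstairs it gives `d ≤ dimH L` (`IsAttractor.le_dimH`). Downstairs it
makes the projection bi-Lipschitz on `L` (`IsAttractor.biLipschitzOn`): without rotations a linear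
map commutes with the scaling of each piece, so separation at the first generation carries over to
all generations. Only linearity and norm at most 1 of the projection matter. -/

/-! ### Hausdorff measure, finite covers and separated sets -/

open MeasureTheory Filter Topology in
/-- A lower bound on the `d`-dimensional size of all finite covers of a compact set is a lower
bound on its Hausdorff measure. -/
theorem IsCompact.le_hausdorffMeasure_of_finite_covers {X : Type*} [MetricSpace X]
    [MeasurableSpace X] [BorelSpace X] {K : Set X} (hK : IsCompact K) {d : ℝ} (hd : 0 < d)
    {c : ℝ≥0∞}
    (h : ∀ (J : Finset ℕ) (U : ℕ → Set X), K ⊆ ⋃ j ∈ J, U j → c ≤ ∑ j ∈ J, ediam (U j) ^ d) :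
    c ≤ μH[d] K := by
  rw [Measure.hausdorffMeasure_apply]
  -- Any scale would do, as `h` does not restrict diameters; 1 keeps them finite.
  refine le_iSup₂_of_le 1 one_pos (le_iInf fun t => le_iInf fun hKt => le_iInf fun ht => ?_)
  refine ENNReal.le_of_forall_pos_le_add fun ε hε _ => ?_
  obtain ⟨ε', hε', hsum⟩ := ENNReal.exists_pos_sum_of_countable (ENNReal.coe_pos.2 hε).ne' ℕ
  -- Open enlargements at summable cost, so that compactness leaves a finite cover.
  have key : ∀ n, ∃ U, IsOpen U ∧ t n ⊆ U ∧
      ediam U ^ d ≤ (⨆ _ : (t n).Nonempty, ediam (t n) ^ d) + ε' n := by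
    intro n
    rcases (t n).eq_empty_or_nonempty with hn | hn
    · exact ⟨∅, isOpen_empty, hn.subset, by simp [hd]⟩
    have hlim : Tendsto (fun δ : ℝ≥0 => (ediam (t n) + 2 * δ) ^ d) (𝓝[>] 0)
        (𝓝 ((ediam (t n) + 2 * (0 : ℝ≥0)) ^ d)) := by
      refine Tendsto.mono_left ?_ nhdsWithin_le_nhds
      refine (ENNReal.continuous_rpow_const.tendsto _).comp ?_
      refine tendsto_const_nhds.add (ENNReal.Tendsto.const_mul ?_ (Or.inr (by simp)))
      exact ENNReal.tendsto_coe.2 tendsto_id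
    have hfin : ediam (t n) ^ d ≠ ∞ :=
      ENNReal.rpow_ne_top_of_nonneg hd.le ((ht n).trans_lt ENNReal.one_lt_top).ne
    have hlt : (ediam (t n) + 2 * (0 : ℝ≥0)) ^ d < ediam (t n) ^ d + ε' n := by
      simpa using ENNReal.lt_add_right hfin (ENNReal.coe_pos.2 (hε' n)).ne'
    obtain ⟨δ, hδ, hδ0⟩ := ((hlim.eventually_lt_const hlt).and self_mem_nhdsWithin).exists
    refine ⟨thickening δ (t n), isOpen_thickening, self_subset_thickening hδ0 _, ?_⟩
    simp only [hn, ciSup_pos]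
    exact (ENNReal.rpow_le_rpow (ediam_thickening_le δ) hd.le).trans hδ.le
  choose U hUo htU hU using key
  obtain ⟨J, hJ⟩ := hK.elim_finite_subcover U hUo
    (hKt.trans (iUnion_mono htU))
  calc c ≤ ∑ j ∈ J, ediam (U j) ^ d := h J U hJ
    _ ≤ ∑ j ∈ J, ((⨆ _ : (t j).Nonempty, ediam (t j) ^ d) + ε' j) :=
        Finset.sum_le_sum fun j _ => hU j
    _ ≤ ∑' j, ((⨆ _ : (t j).Nonempty, ediam (t j) ^ d) + ε' j) := ENNReal.sum_le_tsum J
    _ = (∑' j, ⨆ _ : (t j).Nonempty, ediam (t j) ^ d) + ∑' j, (ε' j : ℝ≥0∞) := ENNReal.tsum_add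
    _ ≤ _ := by gcongr

open MeasureTheory Filter Topology in
/-- A totally bounded set of dimension larger than `d` contains large separated sets at
arbitrarily small scales. -/
theorem exists_isSeparated_of_lt_dimH {X : Type*} [MetricSpace X] {A : Set X}
    (hA : TotallyBounded A) {d : ℝ≥0} (hd : (d : ℝ≥0∞) < dimH A) {c δ₀ : ℝ≥0} (hc : 0 < c)
    (hδ₀ : 0 < δ₀) :
    ∃ δ : ℝ≥0, 0 < δ ∧ δ < δ₀ ∧ ∃ T : Finset X, (T : Set X) ⊆ A ∧ IsSeparated δ (T : Set X) ∧
      1 ≤ (T.card : ℝ≥0) * (c * δ) ^ (d : ℝ) := by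
  borelize X
  have hT : ∀ δ : ℝ≥0, ∃ T : Finset X, 0 < δ →
      (T : Set X) ⊆ A ∧ IsSeparated δ (T : Set X) ∧ IsCover δ A (T : Set X) := by
    intro δ
    rcases eq_or_ne δ 0 with rfl | hδ
    · exact ⟨∅, fun h => absurd h (lt_irrefl _)⟩
    obtain ⟨N, hNA, hNfin, hN⟩ :=
      exists_finite_isCover_of_totallyBounded (ε := δ / 2) (by positivity) hA
    have hp : packingNumber δ A ≠ ⊤ := by
      have h1 := packingNumber_two_mul_le_externalCoveringNumber (δ / 2) A
      have h2 := hN.externalCoveringNumber_le_encard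
      rw [show ((2 : ℝ≥0) * (δ / 2)) = δ by field_simp] at h1
      exact ((h1.trans h2).trans_lt hNfin.encard_lt_top).ne
    have hfin : (maximalSeparatedSet δ A).Finite := by
      rw [← Set.encard_lt_top_iff, encard_maximalSeparatedSet hp]
      exact hp.lt_top
    refine ⟨hfin.toFinset, fun _ => ?_⟩
    rw [hfin.coe_toFinset]
    exact ⟨maximalSeparatedSet_subset, isSeparated_maximalSeparatedSet,
      isCover_maximalSeparatedSet hp⟩
  choose T hT using hT
  -- Maximal separated sets are also covers. If all had fewer than `(cδ)⁻ᵈ` points, then for `d < s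
  -- < dimH A` the covering sums would be `O(δ^(s-d))`, forcing `μH[s] A = 0` instead of `∞`.
  by_contra! H
  obtain ⟨s, hds, hs⟩ := ENNReal.lt_iff_exists_nnreal_btwn.1 hd
  have hds' : d < s := ENNReal.coe_lt_coe.1 hds
  have htop := hausdorffMeasure_of_lt_dimH hs
  have hpos : ∀ᶠ δ : ℝ≥0 in 𝓝[>] 0, 0 < δ := self_mem_nhdsWithin
  have hsmall : ∀ᶠ δ : ℝ≥0 in 𝓝[>] 0, δ < δ₀ :=
    nhdsWithin_le_nhds (gt_mem_nhds hδ₀)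
  have hr : Tendsto (fun δ : ℝ≥0 => ((2 * δ : ℝ≥0) : ℝ≥0∞)) (𝓝[>] 0) (𝓝 0) := by
    have : Tendsto (fun δ : ℝ≥0 => 2 * δ) (𝓝 0) (𝓝 (2 * 0)) := tendsto_id.const_mul 2
    rw [mul_zero] at this
    rw [← ENNReal.coe_zero]
    exact ENNReal.tendsto_coe.2 (this.mono_left nhdsWithin_le_nhds)
  have hball : ∀ (δ : ℝ≥0) (x : X), ediam (closedBall x δ) ≤ ((2 * δ : ℝ≥0) : ℝ≥0∞) := by
    intro δ x
    refine ediam_le fun y hy z hz => ?_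
    rw [edist_nndist, ENNReal.coe_le_coe, ← NNReal.coe_le_coe, coe_nndist]
    have := dist_triangle_right y z x
    rw [mem_closedBall] at hy hz
    push_cast
    linarith
  have hle := Measure.hausdorffMeasure_le_liminf_sum (ι := fun δ => T δ) (s : ℝ) A
    _ hr (fun δ x => closedBall (x : X) δ) (.of_forall fun δ x => hball δ x) (by
      filter_upwards [hpos] with δ hδ
      have := isCover_iff_subset_iUnion_closedBall.1 (hT δ hδ).2.2
      rwa [iUnion_subtype])
  have hlim : Tendsto (fun δ : ℝ≥0 => (((c ^ (d : ℝ))⁻¹ * 2 ^ (s : ℝ) * δ ^ ((s : ℝ) - d) : ℝ≥0) :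
      ℝ≥0∞)) (𝓝[>] 0) (𝓝 0) := by
    have hsd : (0 : ℝ) < s - d := sub_pos.2 (by exact_mod_cast hds')
    have h1 : Tendsto (fun δ : ℝ≥0 => δ ^ ((s : ℝ) - d)) (𝓝 0) (𝓝 (0 ^ ((s : ℝ) - d))) :=
      (NNReal.continuousAt_rpow_const (Or.inr hsd.le)).tendsto
    rw [NNReal.zero_rpow hsd.ne'] at h1
    have h2 := h1.const_mul ((c ^ (d : ℝ))⁻¹ * 2 ^ (s : ℝ))
    rw [mul_zero] at h2
    rw [← ENNReal.coe_zero]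
    exact ENNReal.tendsto_coe.2 (h2.mono_left nhdsWithin_le_nhds)
  have hbound : ∀ᶠ δ : ℝ≥0 in 𝓝[>] 0, ∑ x : T δ, ediam (closedBall (x : X) δ) ^ (s : ℝ) ≤
      (((c ^ (d : ℝ))⁻¹ * 2 ^ (s : ℝ) * δ ^ ((s : ℝ) - d) : ℝ≥0) : ℝ≥0∞) := by
    filter_upwards [hpos, hsmall] with δ hδ hδ'
    have hcard := (H δ hδ hδ' (T δ) (hT δ hδ).1 (hT δ hδ).2.1).le
    calc ∑ x : T δ, ediam (closedBall (x : X) δ) ^ (s : ℝ)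
        ≤ ∑ x : T δ, ((2 * δ : ℝ≥0) : ℝ≥0∞) ^ (s : ℝ) :=
          Finset.sum_le_sum fun x _ => ENNReal.rpow_le_rpow (hball δ x) s.coe_nonneg
      _ = (((T δ).card * (2 * δ) ^ (s : ℝ) : ℝ≥0) : ℝ≥0∞) := by
          rw [← ENNReal.coe_rpow_of_nonneg _ s.coe_nonneg]
          simp
      _ ≤ _ := by
          rw [ENNReal.coe_le_coe]
          have hcd : 0 < c ^ (d : ℝ) := NNReal.rpow_pos hc
          have hδd : 0 < δ ^ (d : ℝ) := NNReal.rpow_pos hδ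
          rw [NNReal.mul_rpow] at hcard ⊢
          rw [NNReal.rpow_sub hδ.ne']
          calc ((T δ).card : ℝ≥0) * (2 ^ (s : ℝ) * δ ^ (s : ℝ))
              = ((T δ).card * (c ^ (d : ℝ) * δ ^ (d : ℝ))) *
                ((c ^ (d : ℝ))⁻¹ * 2 ^ (s : ℝ) * (δ ^ (s : ℝ) / δ ^ (d : ℝ))) := by
                  field_simp
            _ ≤ 1 * _ := by gcongr
            _ = _ := one_mul _
  have hzero : μH[(s : ℝ)] A ≤ 0 := by
    refine hle.trans ((liminf_le_liminf hbound).trans_eq hlim.liminf_eq)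
  rw [htop] at hzero
  exact absurd hzero (by simp)

/-! ### Attractors with disjoint first generation pieces -/

namespace HomothetyIFS

theorem dist_map {p : ℕ} (Φ : HomothetyIFS p) (i : Fin p) (x y : E3) :
    dist (Φ.map i x) (Φ.map i y) = Φ.ratio i * dist x y := by
  simp [map, dist_eq_norm, ← smul_sub, norm_smul, abs_of_pos (Φ.ratio_pos i)]

theorem continuous_map {p : ℕ} (Φ : HomothetyIFS p) (i : Fin p) : Continuous (Φ.map i) := by
  unfold map
  fun_prop

theorem IsAttractor.mapsTo {p : ℕ} {Φ : HomothetyIFS p} {L : Set E3} (hL : Φ.IsAttractor L)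
    (i : Fin p) : MapsTo (Φ.map i) L L := fun x hx => by
  rw [hL.2.2]
  exact mem_iUnion.2 ⟨i, x, hx, rfl⟩

theorem IsAttractor.exists_eq_map {p : ℕ} {Φ : HomothetyIFS p} {L : Set E3}
    (hL : Φ.IsAttractor L) {x : E3} (hx : x ∈ L) : ∃ i, ∃ y ∈ L, Φ.map i y = x := by
  rw [hL.2.2] at hx
  simpa using hx

/-- A nonempty compact set mapped into itself by every similitude of a nonempty family contains
the attractor of the family. -/
theorem exists_isAttractor_subset {p : ℕ} (hp : 0 < p) (Φ : HomothetyIFS p) {K : Set E3}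
    (hK : IsCompact K) (hne : K.Nonempty) (hm : ∀ i, MapsTo (Φ.map i) K K) :
    ∃ L, Φ.IsAttractor L ∧ L ⊆ K := by
  -- The attractor is the greatest fixed point of `F`. It is closed because its closure is a
  -- post-fixed point, and nonempty because it contains the fixed point of one of the maps.
  let F : Set E3 →o Set E3 :=
    ⟨fun A => K ∩ ⋃ i, Φ.map i '' A, fun A B h =>
      inter_subset_inter_right _ (iUnion_mono fun i => image_mono h)⟩
  have hfix : F F.gfp = F.gfp := F.map_gfp
  have hsub : F.gfp ⊆ K := fun x hx => by
    rw [← hfix] at hx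
    exact hx.1
  have hclosed : IsClosed F.gfp := by
    have hcl : closure F.gfp ⊆ K := closure_minimal hsub hK.isClosed
    have hcomp : IsCompact (closure F.gfp) := hK.of_isClosed_subset isClosed_closure hcl
    have hle : closure F.gfp ≤ F (closure F.gfp) := by
      have hFcl : IsClosed (F (closure F.gfp)) :=
        hK.isClosed.inter (isClosed_iUnion_of_finite fun i =>
          (hcomp.image (Φ.continuous_map i)).isClosed)
      refine closure_minimal ?_ hFcl
      calc F.gfp = F F.gfp := hfix.symm
        _ ≤ _ := F.monotone subset_closure
    exact isClosed_of_closure_subset (F.le_gfp hle)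
  have hnonempty : F.gfp.Nonempty := by
    obtain ⟨x, hx⟩ := hne
    let i : Fin p := ⟨0, hp⟩
    have hcontr : ContractingWith (Φ.ratio i).toNNReal ((hm i).restrict (Φ.map i) K K) := by
      refine ⟨Real.toNNReal_lt_one.2 (Φ.ratio_lt_one i),
        LipschitzWith.of_dist_le_mul fun a b => ?_⟩
      rw [Real.coe_toNNReal _ (Φ.ratio_pos i).le]
      exact (Φ.dist_map i a b).le
    obtain ⟨y, hyK, hy, -⟩ := hcontr.exists_fixedPoint' hK.isComplete (hm i) hx (edist_ne_top _ _)
    have hle : ({y} : Set E3) ≤ F {y} := by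
      rw [singleton_subset_iff]
      exact ⟨hyK, mem_iUnion.2 ⟨i, y, rfl, hy⟩⟩
    exact ⟨y, F.le_gfp hle rfl⟩
  refine ⟨F.gfp, ⟨hnonempty, hK.of_isClosed_subset hclosed hsub, ?_⟩, hsub⟩
  conv_lhs => rw [← hfix]
  refine inter_eq_right.2 (iUnion_subset fun i => ?_)
  rintro _ ⟨x, hx, rfl⟩
  exact hm i (hsub hx)

/-- The first generation pieces of an attractor are uniformly separated under a continuous map
that separates them. -/
theorem IsAttractor.exists_gap {p : ℕ} {Φ : HomothetyIFS p} {L : Set E3} (hL : Φ.IsAttractor L)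
    {Y : Type*} [MetricSpace Y] {f : E3 → Y} (hf : Continuous f)
    (hdisj : ∀ i j, i ≠ j → ∀ x ∈ L, ∀ y ∈ L, f (Φ.map i x) ≠ f (Φ.map j y)) :
    ∃ a : ℝ, 0 < a ∧ ∀ i j, i ≠ j → ∀ x ∈ L, ∀ y ∈ L,
      a ≤ dist (f (Φ.map i x)) (f (Φ.map j y)) := by
  have hpair : ∀ ij : Fin p × Fin p, ∃ a : ℝ, 0 < a ∧ (ij.1 ≠ ij.2 → ∀ x ∈ L, ∀ y ∈ L,
      a ≤ dist (f (Φ.map ij.1 x)) (f (Φ.map ij.2 y))) := by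
    rintro ⟨i, j⟩
    by_cases hij : i = j
    · exact ⟨1, one_pos, fun h => absurd hij h⟩
    have hcont : Continuous fun z : E3 × E3 => dist (f (Φ.map i z.1)) (f (Φ.map j z.2)) :=
      (hf.comp ((Φ.continuous_map i).comp continuous_fst)).dist
        (hf.comp ((Φ.continuous_map j).comp continuous_snd))
    obtain ⟨z, hz, hmin⟩ := (hL.2.1.prod hL.2.1).exists_isMinOn (hL.1.prod hL.1)
      hcont.continuousOn
    exact ⟨_, dist_pos.2 (hdisj i j hij z.1 hz.1 z.2 hz.2), fun _ x hx y hy =>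
      hmin (mk_mem_prod hx hy)⟩
  choose a ha hle using hpair
  rcases isEmpty_or_nonempty (Fin p × Fin p) with hempty | hnonempty
  · exact ⟨1, one_pos, fun i j => (hempty.false (i, j)).elim⟩
  obtain ⟨k, hk⟩ := Finite.exists_min a
  exact ⟨a k, ha k, fun i j hij x hx y hy => (hk (i, j)).trans (hle (i, j) hij x hx y hy)⟩

/-- A linear map that separates the first generation pieces of an attractor is bi-Lipschitz on
the attractor. -/
theorem IsAttractor.biLipschitzOn {p : ℕ} {Φ : HomothetyIFS p} {L : Set E3}
    (hL : Φ.IsAttractor L) {F : Type*} [NormedAddCommGroup F] [NormedSpace ℝ F] (f : E3 →L[ℝ] F)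
    (hdisj : ∀ i j, i ≠ j → ∀ x ∈ L, ∀ y ∈ L, f (Φ.map i x) ≠ f (Φ.map j y)) :
    BiLipschitzOn f L := by
  refine ⟨⟨‖f‖₊, f.lipschitz.lipschitzOnWith⟩, ?_⟩
  obtain ⟨a, ha, hgap⟩ := hL.exists_gap f.continuous hdisj
  have hscale : ∀ i x y, dist (f (Φ.map i x)) (f (Φ.map i y)) = Φ.ratio i * dist (f x) (f y) := by
    intro i x y
    simp [map, dist_eq_norm, ← smul_sub, norm_smul, abs_of_pos (Φ.ratio_pos i)]
  -- A maximal pair for this function replaces iteration over generations. If the maximum were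
  -- positive, a pair in one piece would rescale to a pair with a larger value, while for distinct
  -- pieces the gap `a` makes the value nonpositive.
  have hcont : Continuous fun z : E3 × E3 =>
      a * dist z.1 z.2 - diam L * dist (f z.1) (f z.2) := by fun_prop
  obtain ⟨x, hx, y, hy, hmax⟩ : ∃ x ∈ L, ∃ y ∈ L, ∀ u ∈ L, ∀ v ∈ L,
      a * dist u v - diam L * dist (f u) (f v) ≤ a * dist x y - diam L * dist (f x) (f y) := by
    obtain ⟨z, hz, hmax⟩ := (hL.2.1.prod hL.2.1).exists_isMaxOn (hL.1.prod hL.1)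
      hcont.continuousOn
    exact ⟨z.1, hz.1, z.2, hz.2, fun u hu v hv => isMaxOn_iff.1 hmax (u, v) ⟨hu, hv⟩⟩
  have hneg : a * dist x y - diam L * dist (f x) (f y) ≤ 0 := by
    by_contra! hpos
    obtain ⟨i, u, hu, rfl⟩ := hL.exists_eq_map hx
    obtain ⟨j, v, hv, rfl⟩ := hL.exists_eq_map hy
    by_cases hij : i = j
    · subst hij
      rw [hscale, dist_map] at hpos
      have h1 := hmax u hu v hv
      rw [hscale, dist_map] at h1
      have hfactor : a * (Φ.ratio i * dist u v) - diam L * (Φ.ratio i * dist (f u) (f v)) =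
          Φ.ratio i * (a * dist u v - diam L * dist (f u) (f v)) := by ring
      rw [hfactor] at hpos h1
      have hM := pos_of_mul_pos_right hpos (Φ.ratio_pos i).le
      exact absurd h1 (mul_lt_of_lt_one_left hM (Φ.ratio_lt_one i)).not_ge
    · have h1 := hgap i j hij u hu v hv
      have h2 := dist_le_diam_of_mem hL.2.1.isBounded hx hy
      have h3 := mul_le_mul h2 h1 ha.le diam_nonneg
      linarith
  refine ⟨(diam L / a).toNNReal, AntilipschitzWith.of_le_mul_dist fun u v => ?_⟩
  rw [Real.coe_toNNReal _ (by positivity)]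
  have h1 := hmax u u.2 v v.2
  change dist (u : E3) v ≤ diam L / a * dist (f u) (f v)
  rw [div_mul_eq_mul_div, le_div_iff₀ ha]
  linarith

/-- Lower bound for the dimension of an attractor whose first generation pieces are disjoint. -/
theorem IsAttractor.le_dimH {p : ℕ} {Φ : HomothetyIFS p} {L : Set E3} (hL : Φ.IsAttractor L)
    (hdisj : ∀ i j, i ≠ j → ∀ x ∈ L, ∀ y ∈ L, Φ.map i x ≠ Φ.map j y) {d : ℝ≥0} (hd : 0 < d)
    (hsum : 1 ≤ ∑ i, Φ.ratio i ^ (d : ℝ)) : (d : ℝ≥0∞) ≤ dimH L := by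
  have hd' : (0 : ℝ) < d := by exact_mod_cast hd
  obtain ⟨a, ha, hgap⟩ := hL.exists_gap continuous_id hdisj
  simp only [id] at hgap
  -- A lone ratio has `rᵈ < 1`. A second piece is what makes the subfamilies `I i` below proper.
  have hp : ∀ i : Fin p, ∃ j, j ≠ i := by
    intro i
    by_contra! H
    have : ∑ j, Φ.ratio j ^ (d : ℝ) = Φ.ratio i ^ (d : ℝ) :=
      Fintype.sum_eq_single i fun j hj => absurd (H j) hj
    exact absurd (hsum.trans_eq this)
      (Real.rpow_lt_one (Φ.ratio_pos i).le (Φ.ratio_lt_one i) hd').not_ge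
  have hcover : ∀ (J : Finset ℕ) (U : ℕ → Set E3), L ⊆ ⋃ j ∈ J, U j →
      ENNReal.ofReal a ^ (d : ℝ) ≤ ∑ j ∈ J, ediam (U j) ^ (d : ℝ) := by
    classical
    intro J
    induction J using Finset.strongInduction with
    | H J ih =>
    intro U hU
    -- If every set is smaller than the gap, each meets at most one piece. The cover splits into
    -- disjoint subfamilies, which pull back to smaller covers of `L`; `∑ rᵢᵈ ≥ 1` recombines their
    -- bounds.
    by_cases hbig : ∃ j ∈ J, ENNReal.ofReal a ≤ ediam (U j)
    · obtain ⟨j, hj, hja⟩ := hbig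
      exact (ENNReal.rpow_le_rpow hja hd'.le).trans
        (Finset.single_le_sum (f := fun j => ediam (U j) ^ (d : ℝ)) (fun _ _ => zero_le) hj)
    push Not at hbig
    let I : Fin p → Finset ℕ := fun i => {j ∈ J | ∃ x ∈ L, Φ.map i x ∈ U j}
    have hIdisj : ∀ i k, i ≠ k → Disjoint (I i) (I k) := by
      intro i k hik
      refine Finset.disjoint_left.2 fun j hi hk => ?_
      obtain ⟨hj, x, hx, hxU⟩ := Finset.mem_filter.1 hi
      obtain ⟨-, y, hy, hyU⟩ := Finset.mem_filter.1 hk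
      refine absurd (hbig j hj) (not_lt.2 ?_)
      calc ENNReal.ofReal a ≤ edist (Φ.map i x) (Φ.map k y) := by
            rw [edist_dist]
            exact ENNReal.ofReal_le_ofReal (hgap i k hik x hx y hy)
        _ ≤ _ := edist_le_ediam_of_mem hxU hyU
    have hmem : ∀ i, ∀ x ∈ L, ∃ j ∈ I i, Φ.map i x ∈ U j := by
      intro i x hx
      obtain ⟨j, hj, hxj⟩ := mem_iUnion₂.1 (hU (hL.mapsTo i hx))
      exact ⟨j, Finset.mem_filter.2 ⟨hj, x, hx, hxj⟩, hxj⟩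
    have hIss : ∀ i, I i ⊂ J := by
      intro i
      refine ⟨Finset.filter_subset _ _, fun hJ => ?_⟩
      obtain ⟨k, hk⟩ := hp i
      obtain ⟨x, hx⟩ := hL.1
      obtain ⟨j, hj, -⟩ := hmem k x hx
      exact Finset.disjoint_left.1 (hIdisj k i hk) hj (hJ (Finset.mem_filter.1 hj).1)
    have hpiece : ∀ i, ENNReal.ofReal (Φ.ratio i ^ (d : ℝ)) * ENNReal.ofReal a ^ (d : ℝ) ≤
        ∑ j ∈ I i, ediam (U j) ^ (d : ℝ) := by
      intro i
      have hr := Φ.ratio_pos i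
      have hdiam : ∀ j, ENNReal.ofReal (Φ.ratio i) * ediam (Φ.map i ⁻¹' U j) ≤ ediam (U j) := by
        intro j
        have hanti : AntilipschitzWith (Φ.ratio i)⁻¹.toNNReal (Φ.map i) := by
          refine AntilipschitzWith.of_le_mul_dist fun x y => ?_
          rw [dist_map, Real.coe_toNNReal _ (by positivity), inv_mul_cancel_left₀ hr.ne']
        have h1 := mul_le_mul_right (hanti.ediam_preimage_le (U j)) (ENNReal.ofReal (Φ.ratio i))
        refine h1.trans_eq ?_
        rw [← mul_assoc, ENNReal.ofNNReal_toNNReal, ← ENNReal.ofReal_mul hr.le,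
          mul_inv_cancel₀ hr.ne', ENNReal.ofReal_one, one_mul]
      have h1 := ih (I i) (hIss i) (fun j => Φ.map i ⁻¹' U j) fun x hx => by
        simpa using hmem i x hx
      calc _ ≤ ENNReal.ofReal (Φ.ratio i ^ (d : ℝ)) *
            ∑ j ∈ I i, ediam (Φ.map i ⁻¹' U j) ^ (d : ℝ) := by gcongr
        _ = ∑ j ∈ I i, (ENNReal.ofReal (Φ.ratio i) * ediam (Φ.map i ⁻¹' U j)) ^ (d : ℝ) := by
            rw [Finset.mul_sum]
            refine Finset.sum_congr rfl fun j _ => ?_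
            rw [ENNReal.mul_rpow_of_nonneg _ _ hd'.le, ENNReal.ofReal_rpow_of_pos hr]
        _ ≤ _ := Finset.sum_le_sum fun j _ => ENNReal.rpow_le_rpow (hdiam j) hd'.le
    calc ENNReal.ofReal a ^ (d : ℝ)
        ≤ ENNReal.ofReal (∑ i, Φ.ratio i ^ (d : ℝ)) * ENNReal.ofReal a ^ (d : ℝ) :=
          le_mul_of_one_le_left' (by simpa using ENNReal.ofReal_le_ofReal hsum)
      _ = ∑ i, ENNReal.ofReal (Φ.ratio i ^ (d : ℝ)) * ENNReal.ofReal a ^ (d : ℝ) := by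
          rw [ENNReal.ofReal_sum_of_nonneg fun i _ => Real.rpow_nonneg (Φ.ratio_pos i).le _,
            Finset.sum_mul]
      _ ≤ ∑ i, ∑ j ∈ I i, ediam (U j) ^ (d : ℝ) := Finset.sum_le_sum fun i _ => hpiece i
      _ = ∑ j ∈ Finset.univ.biUnion I, ediam (U j) ^ (d : ℝ) :=
          (Finset.sum_biUnion fun i _ k _ hik => hIdisj i k hik).symm
      _ ≤ _ := Finset.sum_le_sum_of_subset (Finset.biUnion_subset.2 fun i _ => (hIss i).1)
  have hmeas := hL.2.1.le_hausdorffMeasure_of_finite_covers hd' hcover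
  refine le_dimH_of_hausdorffMeasure_ne_zero fun h0 => ?_
  rw [h0] at hmeas
  exact absurd hmeas (not_le.2 (ENNReal.rpow_pos (by simpa using ha) ENNReal.ofReal_ne_top))

end HomothetyIFS

/-! ### Cylinders at a given scale and the separated subsystem -/

namespace HomothetyIFS

/-- Test the invariance at the boundary point of the ball in the direction of the shift. -/
theorem PreservesBall.norm_shift_le {q : ℕ} {Ψ : HomothetyIFS q} {R : ℝ} (hR : 0 < R)
    (h : Ψ.PreservesBall R) (i : Fin q) : ‖Ψ.shift i‖ ≤ (1 - Ψ.ratio i) * R := by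
  have hr := Ψ.ratio_pos i
  rcases eq_or_ne (Ψ.shift i) 0 with h0 | h0
  · rw [h0, norm_zero]
    exact mul_nonneg (sub_nonneg.2 (Ψ.ratio_lt_one i).le) hR.le
  have hw : 0 < ‖Ψ.shift i‖ := norm_pos_iff.2 h0
  have hx : (R / ‖Ψ.shift i‖) • Ψ.shift i ∈ closedBall (0 : E3) R := by
    rw [mem_closedBall_zero_iff, norm_smul, Real.norm_of_nonneg (by positivity),
      div_mul_cancel₀ _ hw.ne']
  have h1 := h i hx
  have h2 : Ψ.map i ((R / ‖Ψ.shift i‖) • Ψ.shift i) =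
      (Ψ.ratio i * (R / ‖Ψ.shift i‖) + 1) • Ψ.shift i := by
    rw [map, add_smul, one_smul, smul_smul]
  rw [h2, mem_closedBall_zero_iff, norm_smul, Real.norm_of_nonneg (by positivity), add_mul,
    mul_assoc, div_mul_cancel₀ _ hw.ne'] at h1
  linarith

/-- The attractor is contained in every reference ball. -/
theorem IsAttractor.subset_closedBall {q : ℕ} {Ψ : HomothetyIFS q} {K : Set E3}
    (hK : Ψ.IsAttractor K) {R : ℝ} (hR : 0 < R) (h : Ψ.PreservesBall R) :
    K ⊆ closedBall 0 R := by
  obtain ⟨x, hx, hmax⟩ := hK.2.1.exists_isMaxOn hK.1 continuous_norm.continuousOn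
  have hxR : ‖x‖ ≤ R := by
    obtain ⟨i, y, hy, hyx⟩ := hK.exists_eq_map hx
    have h1 : ‖y‖ ≤ ‖x‖ := hmax hy
    have h2 : ‖x‖ ≤ Ψ.ratio i * ‖y‖ + ‖Ψ.shift i‖ := by
      rw [← hyx, map]
      refine (norm_add_le _ _).trans_eq ?_
      rw [norm_smul, Real.norm_of_nonneg (Ψ.ratio_pos i).le]
    have h3 := h.norm_shift_le hR i
    have h4 := mul_le_mul_of_nonneg_left h1 (Ψ.ratio_pos i).le
    have h5 := Ψ.ratio_lt_one i
    nlinarith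
  intro y hy
  have h1 : ‖y‖ ≤ ‖x‖ := hmax hy
  exact mem_closedBall_zero_iff.2 (h1.trans hxR)

/-- Every point of the attractor lies in a piece of any prescribed scale, obtained by composing
similitudes of the family. The composition preserves every set preserved by the family. -/
theorem IsAttractor.exists_piece {q : ℕ} {Ψ : HomothetyIFS q} {K : Set E3}
    (hK : Ψ.IsAttractor K) {m : ℝ} (hm : ∀ i, m ≤ Ψ.ratio i) (hm0 : 0 < m) {x : E3} (hx : x ∈ K)
    {δ : ℝ} (hδ : 0 < δ) (hδ1 : δ < 1) :
    ∃ (ρ : ℝ) (v : E3), 0 < ρ ∧ m * δ ≤ ρ ∧ ρ ≤ δ ∧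
      (∀ S : Set E3, (∀ i, MapsTo (Ψ.map i) S S) → MapsTo (fun z => ρ • z + v) S S) ∧
      ∃ y ∈ K, ρ • y + v = x := by
  obtain ⟨i₀, -⟩ := hK.exists_eq_map hx
  have : Nonempty (Fin q) := ⟨i₀⟩
  obtain ⟨k, hk⟩ := Finite.exists_max Ψ.ratio
  -- Stop composing once the ratio drops to `δ`: the last factor costs at most `m`. The alternative
  -- `ρ = 1` is the empty composition, used when `δ ≥ 1`.
  have key : ∀ n : ℕ, ∀ δ : ℝ, 0 < δ → Ψ.ratio k ^ n ≤ δ → ∀ x ∈ K,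
      ∃ (ρ : ℝ) (v : E3), 0 < ρ ∧ (ρ = 1 ∨ m * δ ≤ ρ) ∧ ρ ≤ δ ∧
      (∀ S : Set E3, (∀ i, MapsTo (Ψ.map i) S S) → MapsTo (fun z => ρ • z + v) S S) ∧
      ∃ y ∈ K, ρ • y + v = x := by
    have hone : ∀ δ : ℝ, 1 ≤ δ → ∀ x ∈ K, ∃ (ρ : ℝ) (v : E3), 0 < ρ ∧ (ρ = 1 ∨ m * δ ≤ ρ) ∧
        ρ ≤ δ ∧
        (∀ S : Set E3, (∀ i, MapsTo (Ψ.map i) S S) → MapsTo (fun z => ρ • z + v) S S) ∧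
        ∃ y ∈ K, ρ • y + v = x := fun δ h x hx =>
      ⟨1, 0, one_pos, Or.inl rfl, h, fun S _ z hz => by simpa using hz, x, hx, by simp⟩
    intro n
    induction n with
    | zero => exact fun δ _ h => hone δ (by simpa using h)
    | succ n ih =>
      intro δ hδ hn x hx
      rcases le_or_gt 1 δ with h1 | h1
      · exact hone δ h1 x hx
      obtain ⟨i, y, hy, rfl⟩ := hK.exists_eq_map hx
      have hr := Ψ.ratio_pos i
      have hn' : Ψ.ratio k ^ n ≤ δ / Ψ.ratio i := by
        rw [le_div_iff₀ hr]
        refine le_trans ?_ hn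
        rw [pow_succ]
        exact mul_le_mul_of_nonneg_left (hk i) (pow_nonneg (Ψ.ratio_pos k).le n)
      obtain ⟨ρ, v, hρ, hlow, hup, hS, z, hz, hzy⟩ := ih (δ / Ψ.ratio i) (by positivity) hn' y hy
      have hcomp : ∀ u : E3, (Ψ.ratio i * ρ) • u + (Ψ.ratio i • v + Ψ.shift i) =
          Ψ.map i (ρ • u + v) := fun u => by
        rw [map, smul_add, mul_smul, add_assoc]
      refine ⟨Ψ.ratio i * ρ, Ψ.ratio i • v + Ψ.shift i, by positivity, Or.inr ?_, ?_, ?_, z, hz, ?_⟩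
      · rcases hlow with rfl | hlow
        · have := hm i
          nlinarith
        · rw [← mul_div_assoc, div_le_iff₀ hr] at hlow
          linarith
      · rw [le_div_iff₀ hr] at hup
        linarith
      · intro S hSm u hu
        simp only [hcomp]
        exact hSm i (hS S hSm hu)
      · rw [hcomp, hzy]
  obtain ⟨n, hn⟩ := exists_pow_lt_of_lt_one hδ (Ψ.ratio_lt_one k)
  obtain ⟨ρ, v, hρ, hlow, hup, h⟩ := key n δ hδ hn.le x hx
  exact ⟨ρ, v, hρ, hlow.resolve_left (by linarith), hup, h⟩

/-- Below the dimension of its image under a linear map, an attractor contains a very separated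
attractor on which the linear map is bi-Lipschitz. -/
theorem IsAttractor.exists_verySeparated_subset {q : ℕ} {Ψ : HomothetyIFS q} {K : Set E3}
    (hK : Ψ.IsAttractor K) {F : Type*} [NormedAddCommGroup F] [NormedSpace ℝ F] {f : E3 →L[ℝ] F}
    (hf : ‖f‖ ≤ 1) {R : ℝ} (hR : 0 < R) (hΨ : Ψ.PreservesBall R) {d : ℝ≥0} (hd : 0 < d)
    (hdK : (d : ℝ≥0∞) < dimH (f '' K)) :
    ∃ (p : ℕ) (Φ : HomothetyIFS p) (L : Set E3), Φ.IsAttractor L ∧ L ⊆ K ∧ Φ.VerySeparated R ∧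
      (d : ℝ≥0∞) ≤ dimH L ∧ BiLipschitzOn f L := by
  have hKR := hK.subset_closedBall hR hΨ
  obtain ⟨x₀, hx₀⟩ := hK.1
  obtain ⟨i₀, -⟩ := hK.exists_eq_map hx₀
  have : Nonempty (Fin q) := ⟨i₀⟩
  obtain ⟨k, hk⟩ := Finite.exists_min Ψ.ratio
  have hm := Ψ.ratio_pos k
  lift R to ℝ≥0 using hR.le
  have hR' : 0 < R := hR
  obtain ⟨η, hη, hη1, T, hTK, hTsep, hcard⟩ := exists_isSeparated_of_lt_dimH
    (hK.2.1.image f.continuous).totallyBounded hdK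
    -- Cylinders will have scale `η / (4R)`, which `δ₀` keeps below 1. Their ratios are then at
    -- least `c * η`, so the cardinality bound becomes `∑ ρᵈ ≥ 1`.
    (c := (Ψ.ratio k).toNNReal / (4 * R)) (δ₀ := 4 * R)
    (div_pos (Real.toNNReal_pos.2 hm) (by positivity)) (by positivity)
  have hη' : (0 : ℝ) < η := hη
  have hη1' : (η : ℝ) < 4 * R := by exact_mod_cast hη1
  have hδ1 : (η : ℝ) / (4 * R) < 1 := (div_lt_one (by positivity)).2 hη1'
  have hpick : ∀ y : T, ∃ (ρ : ℝ) (v : E3), 0 < ρ ∧ Ψ.ratio k * (η / (4 * R)) ≤ ρ ∧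
      ρ ≤ η / (4 * R) ∧
      (∀ S : Set E3, (∀ i, MapsTo (Ψ.map i) S S) → MapsTo (fun z => ρ • z + v) S S) ∧
      ∃ z ∈ K, f (ρ • z + v) = y := by
    rintro ⟨y, hy⟩
    obtain ⟨x, hx, rfl⟩ := hTK hy
    obtain ⟨ρ, v, h1, h2, h3, h4, z, hz, hzx⟩ :=
      hK.exists_piece hk hm hx (δ := η / (4 * R)) (by positivity) hδ1
    exact ⟨ρ, v, h1, h2, h3, h4, z, hz, by rw [hzx]⟩
  choose ρ v hρ hlow hup hS z hz hzy using hpick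
  let e : Fin T.card ≃ T := T.equivFin.symm
  let Φ : HomothetyIFS T.card :=
    { ratio := fun i => ρ (e i)
      shift := fun i => v (e i)
      ratio_pos := fun i => hρ (e i)
      ratio_lt_one := fun i => (hup (e i)).trans_lt hδ1 }
  -- The ball has diameter `2R`, so its projected copies stay within `η / 2` of points more than `η`
  -- apart.
  have hnear : ∀ i, ∀ b ∈ closedBall (0 : E3) R, dist (f (Φ.map i b)) (e i : F) ≤ η / 2 := by
    intro i b hb
    have hzR := hKR (hz (e i))
    have h1 : dist b (z (e i)) ≤ 2 * R := by
      have := dist_triangle_right b (z (e i)) 0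
      rw [mem_closedBall] at hb hzR
      linarith
    have h2 : dist (f (Φ.map i b)) (f (Φ.map i (z (e i)))) ≤
        dist (Φ.map i b) (Φ.map i (z (e i))) := by
      rw [dist_eq_norm, dist_eq_norm, ← map_sub]
      exact (f.le_of_opNorm_le hf _).trans_eq (one_mul _)
    rw [dist_map] at h2
    have h3 : f (Φ.map i (z (e i))) = e i := hzy (e i)
    rw [h3] at h2
    refine h2.trans ?_
    calc Φ.ratio i * dist b (z (e i)) ≤ η / (4 * R) * (2 * R) :=
          mul_le_mul (hup (e i)) h1 dist_nonneg (by positivity)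
      _ = η / 2 := by field_simp; norm_num
  have hsep : ∀ i j, i ≠ j → ∀ x ∈ closedBall (0 : E3) R, ∀ y ∈ closedBall (0 : E3) R,
      f (Φ.map i x) ≠ f (Φ.map j y) := by
    intro i j hij x hx y hy heq
    have hne : (e i : F) ≠ e j := fun h => hij (e.injective (Subtype.ext h))
    have h1 : (η : ℝ≥0∞) < edist (e i : F) (e j) := hTsep (e i).2 (e j).2 hne
    rw [edist_nndist, ENNReal.coe_lt_coe, ← NNReal.coe_lt_coe, coe_nndist] at h1
    have h2 := hnear i x hx
    have h3 := hnear j y hy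
    rw [heq] at h2
    have := dist_triangle_left (e i : F) (e j) (f (Φ.map j y))
    linarith
  have hpos : 0 < T.card := by
    rcases Nat.eq_zero_or_pos T.card with h0 | h0
    · rw [h0] at hcard
      simp at hcard
    · exact h0
  obtain ⟨L, hL, hLK⟩ := Φ.exists_isAttractor_subset hpos hK.2.1 hK.1
    fun i => hS (e i) K hK.mapsTo
  have hLR : L ⊆ closedBall 0 R := hLK.trans hKR
  have hsepL : ∀ i j, i ≠ j → ∀ x ∈ L, ∀ y ∈ L, f (Φ.map i x) ≠ f (Φ.map j y) :=
    fun i j hij x hx y hy => hsep i j hij x (hLR hx) y (hLR hy)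
  refine ⟨_, Φ, L, hL, hLK, ⟨fun i => hS (e i) _ hΨ, fun i j hij => ?_⟩, ?_,
    hL.biLipschitzOn f hsepL⟩
  · refine disjoint_left.2 ?_
    rintro _ ⟨x, hx, rfl⟩ ⟨y, hy, hxy⟩
    exact hsep i j hij x hx y hy (by rw [hxy])
  · refine hL.le_dimH (fun i j hij x hx y hy h => hsepL i j hij x hx y hy (by rw [h])) hd ?_
    have hcard' : (1 : ℝ) ≤ T.card * (Ψ.ratio k / (4 * R) * η) ^ (d : ℝ) := by
      rw [← Real.coe_toNNReal _ hm.le]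
      exact_mod_cast hcard
    calc (1 : ℝ) ≤ T.card * (Ψ.ratio k / (4 * R) * η) ^ (d : ℝ) := hcard'
      _ = ∑ i : Fin T.card, (Ψ.ratio k / (4 * R) * η) ^ (d : ℝ) := by simp
      _ ≤ _ := Finset.sum_le_sum fun i _ => by
          refine Real.rpow_le_rpow (by positivity) ?_ d.coe_nonneg
          refine le_trans (le_of_eq ?_) (hlow (e i))
          ring

end HomothetyIFS

/-! ### The theorem -/

theorem proposition4p6 {q : ℕ} (Ψ : HomothetyIFS q) (K : Set E3) (hK : Ψ.IsAttractor K) :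
    HasBiLipschitzProperty K ∧
      ∀ V : Submodule ℝ E3, Module.finrank ℝ V = 2 → ∀ ε : ℝ, 0 < ε →
        ∀ R : ℝ, 0 < R → Ψ.PreservesBall R →
          ∃ (p : ℕ) (Φ : HomothetyIFS p) (L : Set E3),
            Φ.IsAttractor L ∧ L ⊆ K ∧ Φ.VerySeparated R ∧
            dimH (V.orthogonalProjectionOnto '' K) ≤ dimH L + ENNReal.ofReal ε ∧
            BiLipschitzOn V.orthogonalProjectionOnto L := by
  have main : ∀ V : Submodule ℝ E3, Module.finrank ℝ V = 2 → ∀ ε : ℝ, 0 < ε →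
      ∀ R : ℝ, 0 < R → Ψ.PreservesBall R →
        ∃ (p : ℕ) (Φ : HomothetyIFS p) (L : Set E3),
          Φ.IsAttractor L ∧ L ⊆ K ∧ Φ.VerySeparated R ∧
          dimH (V.orthogonalProjectionOnto '' K) ≤ dimH L + ENNReal.ofReal ε ∧
          BiLipschitzOn V.orthogonalProjectionOnto L := by
    intro V _ ε hε R hR hΨ
    -- If the dimension is at most `ε`, a single map suffices: separation is vacuous and no lower
    -- bound on `dimH L` is needed. Otherwise the exponent is taken between `dimH - ε` and `dimH`,
    -- hence positive.
    rcases le_or_gt (dimH (V.orthogonalProjectionOnto '' K)) (ENNReal.ofReal ε) with hdim | hdim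
    · obtain ⟨x₀, hx₀⟩ := hK.1
      obtain ⟨i₀, -⟩ := hK.exists_eq_map hx₀
      let Φ : HomothetyIFS 1 :=
        ⟨fun _ => Ψ.ratio i₀, fun _ => Ψ.shift i₀, fun _ => Ψ.ratio_pos i₀,
          fun _ => Ψ.ratio_lt_one i₀⟩
      obtain ⟨L, hL, hLK⟩ := Φ.exists_isAttractor_subset one_pos hK.2.1 hK.1
        fun _ => hK.mapsTo i₀
      exact ⟨1, Φ, L, hL, hLK, ⟨fun _ => hΨ i₀, fun i j hij => absurd (Subsingleton.elim i j) hij⟩,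
        hdim.trans le_add_self, hL.biLipschitzOn V.orthogonalProjectionOnto
          fun i j hij => absurd (Subsingleton.elim i j) hij⟩
    · have hlt : dimH (V.orthogonalProjectionOnto '' K) - ENNReal.ofReal ε <
          dimH (V.orthogonalProjectionOnto '' K) :=
        ENNReal.sub_lt_self (Real.dimH_ne_top _) (pos_of_gt hdim).ne' (by simpa using hε)
      obtain ⟨d, hd1, hd2⟩ := ENNReal.lt_iff_exists_nnreal_btwn.1 hlt
      have hd : 0 < d := ENNReal.coe_pos.1 (pos_of_gt hd1)
      obtain ⟨p, Φ, L, hL, hLK, hsep, hdL, hbi⟩ := hK.exists_verySeparated_subset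
        V.orthogonalProjectionOnto_norm_le hR hΨ hd hd2
      exact ⟨p, Φ, L, hL, hLK, hsep, tsub_le_iff_right.1 (hd1.le.trans hdL), hbi⟩
  refine ⟨fun V hV ε hε => ?_, main⟩
  obtain ⟨R, hR, hΨ⟩ := Ψ.exists_preservesBall
  obtain ⟨p, Φ, L, -, hLK, -, hdim, hbi⟩ := main V hV ε hε R hR hΨ
  exact ⟨L, hLK, hdim, hbi⟩
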